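/- Let $\Sigma=\{a_1,a_2,\ldots,a_6,\#\}$ be an alphabet of seven distinct symbols, and let $Equal_6$ be the language of all strings $w\in\Sigma^*$ in which every symbol except $\#$ occurs equally often, i.e. $\#_a(w)=\#_b(w)$ for all $a,b\in\Sigma\setminus\{\#\}$, where $\#_a(w)$ denotes the number of occurrences of $a$ in $w$. For strings $x=x_1\cdots x_n$ over $\Sigma$ and $w=\sigma_1\cdots\sigma_n$ over an alphabet (nonempty finite set) $\Gamma$, let $\left[{x\atop w}\right]$ be the string of length $n$ over $\Sigma\times\Gamma$ whose $i$-th symbol is $(x_i,\sigma_i)$. A language $L\subseteq\Sigma^*$ belongs to $\mathrm{CFL}/n$ if there are an alphabet $\Gamma$, a (not necessarily computable) advice function $h:\mathbb{N}\to\Gamma^*$ with $|h(n)|=n$ for all $n\in\mathbb{N}$, and a context-free language $L'$ over $\Sigma\times\Gamma$ such that, for every $x\in\Sigma^*$, $x\in L$ if and only if $\left[{x\atop h(|x|)}\right]\in L'$. Then $Equal_6$ is not in $\mathrm{CFL}/n$. -/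

import Mathlib

/-- The two-track string whose `i`-th symbol is the pair of the `i`-th symbol of `x` (upper track)
and the `i`-th symbol of `w` (lower track). It is only used for strings of equal length. -/
def track {α Γ : Type} (x : List α) (w : List Γ) : List (α × Γ) :=
  List.zip x w

/-- An advice function over the alphabet `Γ`: an arbitrary (not necessarily computable) function
from lengths to strings over `Γ` such that `h n` has length exactly `n`. -/
def IsAdviceFunction {Γ : Type} (h : ℕ → List Γ) : Prop :=
  ∀ n : ℕ, (h n).length = n

/-- The advised family `CFL/n`, restricted to languages over the alphabet `α`: the languages `L`
for which there are an advice alphabet `Γ`, an advice function `h` over `Γ` and a context-free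
language `L'` over the two-track alphabet `α × Γ` such that, for every string `x`, `x` is in `L`
if and only if the two-track string of `x` and `h |x|` is in `L'`. -/
def AdvisedCFL (α : Type) [Finite α] [Nonempty α] : Set (Language α) :=
  {L | ∃ (Γ : Type) (_ : Finite Γ) (_ : Nonempty Γ) (h : ℕ → List Γ) (L' : Language (α × Γ)),
    IsAdviceFunction h ∧ L'.IsContextFree ∧
      ∀ x : List α, x ∈ L ↔ track x (h x.length) ∈ L'}

/-- The seven-letter alphabet consisting of the six symbols `some 0, …, some 5` and the separator
`none`. -/
abbrev Alphabet6 : Type := Option (Fin 6)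

/-- The separator symbol. -/
abbrev separator : Alphabet6 := none

/-- The language `Equal₆` of all strings over the seven-letter alphabet in which all symbols other
than the separator occur equally often. -/
def Equal6 : Language Alphabet6 :=
  {w | ∀ a b : Alphabet6, a ≠ separator → b ≠ separator → w.count a = w.count b}

/-! This is a pigeonhole and exchange argument. The test words, one for each `c`, consist of `t`
blocks encoding `c` followed by `t` blocks with complementary letter counts. Separators pad every
block to length `6 * m`, so all test words share one length and hence one advice string. A grammar
with right-hand sides of length at most `R` gives each word a window derived from one nonterminal,
longer than two blocks but at most half the word (`exists_window_of_mem_language`). Such a window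
covers a whole block and misses its complementary partner. Color `c` by the rule, position and
length of its window. There are O(`m ^ 2`) colors but `m ^ 5` values per block, so two words of one
color differ only in the covered block and its partner (`exists_ne_eq_off_of_card_lt`). Exchanging
their windows alters just one half (`swap_halves`); the result is accepted but unbalanced
(`eq_of_leftHalf_append_rightHalf_mem`). -/

namespace ContextFreeGrammar

/-! ### Parse forests and windows of medium length -/

variable {T : Type*} {g : ContextFreeGrammar T}

/-- `g.Yields s w` means that some forest of parse trees with roots `s` has frontier `w`. -/
inductive Yields (g : ContextFreeGrammar T) : List (Symbol T g.NT) → List T → Prop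
  | nil : Yields g [] []
  | terminal (a : T) {s : List (Symbol T g.NT)} {w : List T} (h : Yields g s w) :
      Yields g (Symbol.terminal a :: s) (a :: w)
  | nonterminal (r : ContextFreeRule T g.NT) (hr : r ∈ g.rules) {s : List (Symbol T g.NT)}
      {u v : List T} (hu : Yields g r.output u) (hv : Yields g s v) :
      Yields g (Symbol.nonterminal r.input :: s) (u ++ v)

theorem Yields.append {s t : List (Symbol T g.NT)} {u v : List T}
    (hs : g.Yields s u) (ht : g.Yields t v) : g.Yields (s ++ t) (u ++ v) := by
  induction hs with
  | nil => simpa using ht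
  | terminal a _ ih => exact .terminal a ih
  | nonterminal r hr hu _ _ ih =>
    rw [List.append_assoc]
    exact .nonterminal r hr hu ih

theorem Yields.exists_of_append {s t : List (Symbol T g.NT)} {w : List T}
    (h : g.Yields (s ++ t) w) : ∃ u v, w = u ++ v ∧ g.Yields s u ∧ g.Yields t v := by
  induction s generalizing w with
  | nil => exact ⟨[], w, rfl, .nil, h⟩
  | cons a s ih =>
    rw [List.cons_append] at h
    cases h with
    | terminal a h =>
      obtain ⟨u, v, rfl, hu, hv⟩ := ih h
      exact ⟨a :: u, v, rfl, .terminal a hu, hv⟩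
    | nonterminal r hr hx h =>
      obtain ⟨u, v, rfl, hu, hv⟩ := ih h
      exact ⟨_ ++ u, v, (List.append_assoc ..).symm, .nonterminal r hr hx hu, hv⟩

theorem Yields.map_terminal (w : List T) : g.Yields (w.map Symbol.terminal) w := by
  induction w with
  | nil => exact .nil
  | cons a w ih => exact .terminal a ih

theorem Yields.of_produces {s t : List (Symbol T g.NT)} {w : List T}
    (h : g.Produces s t) (ht : g.Yields t w) : g.Yields s w := by
  obtain ⟨r, hr, h⟩ := h
  obtain ⟨p, q, rfl, rfl⟩ := h.exists_parts
  obtain ⟨_, v, rfl, h, hv⟩ := ht.exists_of_append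
  obtain ⟨u, x, rfl, hu, hx⟩ := h.exists_of_append
  refine Yields.append (Yields.append hu ?_) hv
  simpa using Yields.nonterminal r hr hx .nil

theorem Derives.yields {s : List (Symbol T g.NT)} {w : List T}
    (h : g.Derives s (w.map Symbol.terminal)) : g.Yields s w := by
  induction h using Relation.ReflTransGen.head_induction_on with
  | refl => exact .map_terminal w
  | head h _ ih => exact .of_produces h ih

theorem Derives.append {s s' t t' : List (Symbol T g.NT)}
    (hs : g.Derives s s') (ht : g.Derives t t') : g.Derives (s ++ t) (s' ++ t') :=
  (hs.append_right t).trans (ht.append_left s')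

theorem derives_output {r : ContextFreeRule T g.NT} (hr : r ∈ g.rules) :
    g.Derives [Symbol.nonterminal r.input] r.output :=
  Produces.single ⟨r, hr, ContextFreeRule.Rewrites.input_output⟩

theorem Yields.derives {s : List (Symbol T g.NT)} {w : List T}
    (h : g.Yields s w) : g.Derives s (w.map Symbol.terminal) := by
  induction h with
  | nil => rfl
  | terminal a _ ih => exact ih.append_left [Symbol.terminal a]
  | nonterminal r hr _ _ ihu ihv =>
    rw [List.map_append]
    exact Derives.append (s := [_]) ((derives_output hr).trans ihu) ihv

/-- A long frontier of a parse forest contains the frontier of a subtree of medium length. -/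
theorem Yields.exists_window {s : List (Symbol T g.NT)} {w : List T} (h : g.Yields s w)
    {R K : ℕ} (hR : ∀ r ∈ g.rules, r.output.length ≤ R) (hK : 1 ≤ K)
    (hlen : s.length * K < w.length) :
    ∃ r ∈ g.rules, ∃ x v y : List T, w = x ++ v ++ y ∧ K < v.length ∧ v.length ≤ R * K ∧
      g.Derives [Symbol.nonterminal r.input] (v.map Symbol.terminal) ∧
      g.Derives s (x.map Symbol.terminal ++ [Symbol.nonterminal r.input] ++
        y.map Symbol.terminal) := by
  induction h with
  | nil => simp at hlen
  | @terminal a s w _ ih =>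
    simp only [List.length_cons, add_mul, one_mul] at hlen
    obtain ⟨r, hr, x, v, y, rfl, h1, h2, h3, h4⟩ := ih (by omega)
    exact ⟨r, hr, a :: x, v, y, by simp, h1, h2, h3, h4.append_left [Symbol.terminal a]⟩
  | @nonterminal r hr s u v hu hv ihu ihv =>
    simp only [List.length_cons, List.length_append, add_mul, one_mul] at hlen
    -- Descend into the siblings if they are still too long. Otherwise `u` is longer than `K`: stop
    -- if it is short enough, else descend to its at most `R` children.
    by_cases hvl : s.length * K < v.length
    · obtain ⟨r', hr', x, z, y, rfl, h1, h2, h3, h4⟩ := ihv hvl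
      refine ⟨r', hr', u ++ x, z, y, by simp, h1, h2, h3, ?_⟩
      have := Derives.append (s := [_]) ((derives_output hr).trans hu.derives) h4
      simpa using this
    · by_cases hul : u.length ≤ R * K
      · refine ⟨r, hr, [], u, v, by simp, by omega, hul, (derives_output hr).trans hu.derives, ?_⟩
        exact hv.derives.append_left [_]
      · have := Nat.mul_le_mul_right K (hR r hr)
        obtain ⟨r', hr', x, z, y, rfl, h1, h2, h3, h4⟩ := ihu (by omega)
        refine ⟨r', hr', x, z, y ++ v, by simp, h1, h2, h3, ?_⟩
        have := Derives.append (s := [_]) ((derives_output hr).trans h4) hv.derives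
        simpa using this

/-- Every long word generated by a context-free grammar has a factor of medium length that may be
replaced by any other word derivable from the same nonterminal. -/
theorem exists_window_of_mem_language {w : List T} (h : w ∈ g.language)
    {R K : ℕ} (hR : ∀ r ∈ g.rules, r.output.length ≤ R) (hK : 1 ≤ K) (hlen : K < w.length) :
    ∃ r ∈ g.rules, ∃ x v y : List T, w = x ++ v ++ y ∧ K < v.length ∧ v.length ≤ R * K ∧
      g.Derives [Symbol.nonterminal r.input] (v.map Symbol.terminal) ∧
      ∀ v' : List T, g.Derives [Symbol.nonterminal r.input] (v'.map Symbol.terminal) →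
        x ++ v' ++ y ∈ g.language := by
  obtain ⟨r, hr, x, v, y, h1, h2, h3, h4, h5⟩ :=
    (Derives.yields h).exists_window hR hK (by simpa using hlen)
  refine ⟨r, hr, x, v, y, h1, h2, h3, h4, fun v' hv' => ?_⟩
  rw [mem_language_iff, List.map_append, List.map_append]
  exact h5.trans ((hv'.append_left _).append_right _)

end ContextFreeGrammar

/-- Exchanging the factors at the same position of two words, one word containing `U` and the other
containing `V` inside that position. -/
theorem List.append_swap_eq {α : Type*} {x₁ x₂ x₃ y₁ y₂ y₃ E E' M₁ M₂ U V R R' : List α}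
    (hx : x₁ ++ x₂ ++ x₃ = E ++ M₁ ++ U ++ M₂ ++ R)
    (hy : y₁ ++ y₂ ++ y₃ = E' ++ M₁ ++ V ++ M₂ ++ R')
    (h₁ : x₁.length = y₁.length) (h₂ : x₂.length = y₂.length)
    (hE : E.length = E'.length) (hU : U.length = V.length)
    (hl : E.length ≤ x₁.length) (hl' : x₁.length ≤ E.length + M₁.length)
    (hr : E.length + M₁.length + U.length ≤ x₁.length + x₂.length)
    (hr' : x₁.length + x₂.length ≤ E.length + M₁.length + U.length + M₂.length) :
    x₁ ++ y₂ ++ x₃ = E ++ M₁ ++ V ++ M₂ ++ R := by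
  obtain ⟨a, a', rfl, ha⟩ : ∃ a a', M₁ = a ++ a' ∧ E.length + a.length = x₁.length :=
    ⟨M₁.take (x₁.length - E.length), M₁.drop (x₁.length - E.length), by simp, by simp; omega⟩
  obtain ⟨d, d', rfl, hd⟩ : ∃ d d', M₂ = d ++ d' ∧
      a'.length + U.length + d.length = x₂.length := by
    simp only [length_append] at hr hr'
    refine ⟨M₂.take (x₂.length - (a'.length + U.length)),
      M₂.drop (x₂.length - (a'.length + U.length)), by simp, ?_⟩
    simp; omega
  have hx' : x₁ ++ (x₂ ++ x₃) = (E ++ a) ++ ((a' ++ U ++ d) ++ (d' ++ R)) := by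
    simpa using hx
  have hy' : y₁ ++ (y₂ ++ y₃) = (E' ++ a) ++ ((a' ++ V ++ d) ++ (d' ++ R')) := by
    simpa using hy
  obtain ⟨rfl, hx''⟩ := List.append_inj hx' (by simp; omega)
  obtain ⟨rfl, rfl⟩ := List.append_inj hx'' (by simp; omega)
  obtain ⟨rfl, hy''⟩ := List.append_inj hy' (by simp at h₁ ⊢; omega)
  obtain ⟨rfl, rfl⟩ := List.append_inj hy'' (by simp; omega)
  simp

/-! ### The test words and their letter counts -/

/-- The block of length `6 * m` in which the `j`-th letter occurs `f j` times. -/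
def letterBlock (m : ℕ) (f : Fin 6 → ℕ) : List Alphabet6 :=
  (List.finRange 6).flatMap fun j =>
    List.replicate (f j) (some j) ++ List.replicate (m - f j) separator

/-- The block of length `6 * m` in which the `j`-th letter occurs `m - f j` times. -/
def coletterBlock (m : ℕ) (f : Fin 6 → ℕ) : List Alphabet6 :=
  letterBlock m fun j => m - f j

theorem length_letterBlock {m : ℕ} {f : Fin 6 → ℕ} (hf : ∀ j, f j ≤ m) :
    (letterBlock m f).length = 6 * m := by
  simp [letterBlock, List.length_flatMap, hf]
  ring

theorem length_coletterBlock (m : ℕ) (f : Fin 6 → ℕ) : (coletterBlock m f).length = 6 * m :=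
  length_letterBlock fun _ => Nat.sub_le _ _

theorem count_letterBlock (m : ℕ) (f : Fin 6 → ℕ) (j : Fin 6) :
    (letterBlock m f).count (some j) = f j := by
  fin_cases j <;>
  simp [letterBlock, List.finRange_succ, List.count_replicate]

/-- The occurrence counts of the six letters given by five parameters. -/
def letterCounts {m : ℕ} (v : Fin 5 → Fin m) : Fin 6 → ℕ :=
  Fin.cons 0 fun i => (v i : ℕ)

theorem letterCounts_le {m : ℕ} (v : Fin 5 → Fin m) (j : Fin 6) : letterCounts v j ≤ m := by
  refine Fin.cases ?_ (fun i => ?_) j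
  · simp [letterCounts]
  · simp [letterCounts]

/-- The concatenation of the blocks given by `c`. -/
def leftHalf {m t : ℕ} (c : Fin t → Fin 5 → Fin m) : List Alphabet6 :=
  (List.ofFn c).flatMap fun v => letterBlock m (letterCounts v)

/-- The concatenation of the complementary blocks given by `c`. -/
def rightHalf {m t : ℕ} (c : Fin t → Fin 5 → Fin m) : List Alphabet6 :=
  (List.ofFn c).flatMap fun v => coletterBlock m (letterCounts v)

theorem length_leftHalf {m t : ℕ} (c : Fin t → Fin 5 → Fin m) :
    (leftHalf c).length = t * (6 * m) := by
  simp [leftHalf, List.length_flatMap, length_letterBlock (letterCounts_le _),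
    List.map_ofFn, Function.comp_def]

theorem length_rightHalf {m t : ℕ} (c : Fin t → Fin 5 → Fin m) :
    (rightHalf c).length = t * (6 * m) := by
  simp [rightHalf, List.length_flatMap, length_coletterBlock, List.map_ofFn,
    Function.comp_def]

theorem count_leftHalf {m t : ℕ} (c : Fin t → Fin 5 → Fin m) (j : Fin 6) :
    (leftHalf c).count (some j) = ∑ i, letterCounts (c i) j := by
  simp [leftHalf, List.count_flatMap, Function.comp_def, count_letterBlock, List.map_ofFn,
    List.sum_ofFn]

theorem count_rightHalf {m t : ℕ} (c : Fin t → Fin 5 → Fin m) (j : Fin 6) :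
    (rightHalf c).count (some j) = ∑ i, (m - letterCounts (c i) j) := by
  simp [rightHalf, List.count_flatMap, Function.comp_def, coletterBlock, count_letterBlock,
    List.map_ofFn, List.sum_ofFn]

theorem count_leftHalf_append_rightHalf {m t : ℕ} (c d : Fin t → Fin 5 → Fin m) (j : Fin 6) :
    (leftHalf c ++ rightHalf d).count (some j) + ∑ i, letterCounts (d i) j =
      t * m + ∑ i, letterCounts (c i) j := by
  rw [List.count_append, count_leftHalf, count_rightHalf, add_assoc, ← Finset.sum_add_distrib]
  simp [Nat.sub_add_cancel (letterCounts_le _ _), add_comm]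

theorem leftHalf_append_rightHalf_mem {m t : ℕ} (c : Fin t → Fin 5 → Fin m) :
    leftHalf c ++ rightHalf c ∈ Equal6 := by
  intro a b ha hb
  obtain ⟨i, rfl⟩ := Option.ne_none_iff_exists'.1 ha
  obtain ⟨j, rfl⟩ := Option.ne_none_iff_exists'.1 hb
  have hi := count_leftHalf_append_rightHalf c c i
  have hj := count_leftHalf_append_rightHalf c c j
  omega

/-- Letter `0` is a reference: it occurs exactly `t * m` times whatever `c` and `d` are. Every other
letter must match it, so its sums over `c` and `d` agree, and only the `k`-th summand can differ. -/
theorem eq_of_leftHalf_append_rightHalf_mem {m t : ℕ} {c d : Fin t → Fin 5 → Fin m} {k : Fin t}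
    (hcd : ∀ i, i ≠ k → c i = d i) (h : leftHalf c ++ rightHalf d ∈ Equal6) : c = d := by
  funext i
  by_cases hi : i = k
  · subst hi
    funext j
    have h0 := count_leftHalf_append_rightHalf c d 0
    have hj := count_leftHalf_append_rightHalf c d j.succ
    have hE := h (some 0) (some j.succ) (by simp) (by simp)
    have hsum : ∑ i, letterCounts (c i) j.succ = ∑ i, letterCounts (d i) j.succ := by
      simp only [letterCounts, Fin.cons_zero, Finset.sum_const_zero] at h0
      omega
    rw [← Finset.add_sum_erase _ _ (Finset.mem_univ i),
      ← Finset.add_sum_erase (a := i) _ (fun i => letterCounts (d i) j.succ) (Finset.mem_univ i),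
      Finset.sum_congr rfl fun l hl => by rw [hcd l (Finset.ne_of_mem_erase hl)]] at hsum
    exact Fin.ext (by simpa [letterCounts] using hsum)
  · exact hcd i hi

/-! ### Exchanging windows -/

theorem List.ofFn_eq_take_append {α : Type*} {t : ℕ} (c : Fin t → α) (k : Fin t) :
    List.ofFn c = (List.ofFn c).take k ++ [c k] ++ (List.ofFn c).drop (k + 1) := by
  conv_lhs => rw [← List.take_append_drop k (List.ofFn c),
    List.drop_eq_getElem_cons (by simp)]
  simp

theorem List.exists_ofFn_eq_append {α : Type*} {t : ℕ} {c d : Fin t → α} {k : Fin t}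
    (hcd : ∀ i, i ≠ k → c i = d i) : ∃ p q : List α, p.length = k ∧
      List.ofFn c = p ++ [c k] ++ q ∧ List.ofFn d = p ++ [d k] ++ q := by
  refine ⟨(List.ofFn c).take k, (List.ofFn c).drop (k + 1), by simp, ofFn_eq_take_append c k, ?_⟩
  have h₁ : (List.ofFn c).take k = (List.ofFn d).take k := by
    refine List.ext_getElem (by simp) fun i hi _ => ?_
    simp only [length_take, length_ofFn] at hi
    simpa using hcd _ (Fin.ne_of_val_ne (by simp; omega))
  have h₂ : (List.ofFn c).drop (k + 1) = (List.ofFn d).drop (k + 1) := by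
    refine List.ext_getElem (by simp) fun i hi _ => ?_
    simpa using hcd _ (Fin.ne_of_val_ne (by simp; omega))
  rw [h₁, h₂]
  exact ofFn_eq_take_append d k

/-- Exchanging a factor that covers the `q`-th block, but is not longer than half of the word,
either exchanges the left halves or the right halves of two words that differ only in the blocks
with index `q` modulo `t`. -/
theorem swap_halves {m t q : ℕ} (ht : 0 < t) (hq : q < 2 * t) {c d : Fin t → Fin 5 → Fin m}
    (hcd : ∀ i, i ≠ ⟨q % t, Nat.mod_lt q ht⟩ → c i = d i)
    {x₁ x₂ x₃ y₁ y₂ y₃ : List Alphabet6}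
    (hx : leftHalf c ++ rightHalf c = x₁ ++ x₂ ++ x₃)
    (hy : leftHalf d ++ rightHalf d = y₁ ++ y₂ ++ y₃)
    (h₁ : x₁.length = y₁.length) (h₂ : x₂.length = y₂.length)
    (hl : x₁.length ≤ q * (6 * m)) (hr : (q + 1) * (6 * m) ≤ x₁.length + x₂.length)
    (hlen : x₂.length ≤ t * (6 * m)) :
    x₁ ++ y₂ ++ x₃ = leftHalf d ++ rightHalf c ∨ x₁ ++ y₂ ++ x₃ = leftHalf c ++ rightHalf d := by
  obtain ⟨p, s, hp, hc, hd⟩ := List.exists_ofFn_eq_append hcd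
  simp only at hp
  have hst : p.length + s.length + 1 = t := by
    have := congrArg List.length hc
    simp at this
    omega
  have hL : ∀ l : List (Fin 5 → Fin m),
      (l.flatMap fun v => letterBlock m (letterCounts v)).length = l.length * (6 * m) := by
    simp [List.length_flatMap, length_letterBlock (letterCounts_le _)]
  have hR : ∀ l : List (Fin 5 → Fin m),
      (l.flatMap fun v => coletterBlock m (letterCounts v)).length = l.length * (6 * m) := by
    simp [List.length_flatMap, length_coletterBlock]
  have hB := fun v : Fin 5 → Fin m => length_letterBlock (letterCounts_le v)
  have hC := fun v : Fin 5 → Fin m => length_coletterBlock m (letterCounts v)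
  simp only [leftHalf, rightHalf, hc, hd, List.flatMap_append, List.flatMap_singleton] at hx hy ⊢
  generalize c ⟨q % t, Nat.mod_lt q ht⟩ = u at *
  generalize d ⟨q % t, Nat.mod_lt q ht⟩ = v at *
  have hLp := hL p
  have hLs := hL s
  have hRp := hR p
  have hRs := hR s
  have hBu := hB u
  have hBv := hB v
  have hCu := hC u
  have hCv := hC v
  generalize (p.flatMap fun v => letterBlock m (letterCounts v)) = Lp at *
  generalize (s.flatMap fun v => letterBlock m (letterCounts v)) = Ls at *
  generalize (p.flatMap fun v => coletterBlock m (letterCounts v)) = Rp at *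
  generalize (s.flatMap fun v => coletterBlock m (letterCounts v)) = Rs at *
  have hmul : t * (6 * m) = p.length * (6 * m) + s.length * (6 * m) + 6 * m := by
    rw [← hst]; ring
  rw [add_mul, one_mul] at hr
  -- The partner of block `q` lies `t` blocks away, so a window covering block `q` with length at
  -- most `t` blocks cannot overlap it.
  rcases lt_or_ge q t with hqt | hqt
  · left
    rw [Nat.mod_eq_of_lt hqt] at hp
    rw [hp] at hLp hRp hmul
    have := List.append_swap_eq (x₁ := x₁) (x₂ := x₂) (x₃ := x₃) (y₁ := y₁) (y₂ := y₂) (y₃ := y₃)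
      (E := []) (E' := []) (M₁ := Lp) (M₂ := Ls ++ Rp) (U := letterBlock m (letterCounts u))
      (V := letterBlock m (letterCounts v)) (R := coletterBlock m (letterCounts u) ++ Rs)
      (R' := coletterBlock m (letterCounts v) ++ Rs)
      (by rw [← hx]; simp) (by rw [← hy]; simp) h₁ h₂ rfl (by omega)
      (by simp) (by simp; omega) (by simp; omega) (by simp; omega)
    rw [this]; simp
  · right
    have hqk : q = t + q % t := by
      rw [Nat.mod_eq_sub_mod hqt, Nat.mod_eq_of_lt (by omega)]; omega
    have hqm : q * (6 * m) = t * (6 * m) + p.length * (6 * m) := by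
      rw [← add_mul, hp, ← hqk]
    have := List.append_swap_eq (x₁ := x₁) (x₂ := x₂) (x₃ := x₃) (y₁ := y₁) (y₂ := y₂) (y₃ := y₃)
      (E := Lp ++ letterBlock m (letterCounts u)) (E' := Lp ++ letterBlock m (letterCounts v))
      (M₁ := Ls ++ Rp) (M₂ := Rs) (U := coletterBlock m (letterCounts u))
      (V := coletterBlock m (letterCounts v)) (R := []) (R' := [])
      (by rw [← hx]; simp) (by rw [← hy]; simp) h₁ h₂ (by simp; omega) (by omega)
      (by simp; omega) (by simp; omega) (by simp; omega)
      (by have := congrArg List.length hx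
          simp at this
          simp
          omega)
    rw [this]; simp

/-! ### Pigeonhole, advice track and conclusion -/

/-- A coloring of a power of `α` with fewer than `|α|` colors has a color class containing two
points that differ only in one coordinate, which may depend on the color. -/
theorem exists_ne_eq_off_of_card_lt {ι α κ : Type*} [Fintype ι] [Fintype α]
    [Fintype κ] (f : (ι → α) → κ) (k : κ → ι) (hcard : Fintype.card κ < Fintype.card α) :
    ∃ c d : ι → α, c ≠ d ∧ f c = f d ∧ ∀ i, i ≠ k (f c) → c i = d i := by
  classical
  have hα : 0 < Fintype.card α := by omega
  obtain ⟨a⟩ := Fintype.card_pos_iff.1 hα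
  obtain ⟨e, he⟩ : ∃ e, Fintype.card ι = e + 1 :=
    Nat.exists_eq_add_one.2 (Fintype.card_pos_iff.2 ⟨k (f fun _ => a)⟩)
  obtain ⟨y, hy⟩ := Fintype.exists_lt_card_fiber_of_mul_lt_card (f := f)
    (n := Fintype.card α ^ e) (by
      rw [Fintype.card_fun, he, pow_succ']
      exact Nat.mul_lt_mul_of_pos_right hcard (by positivity))
  -- The color class has more than `|α| ^ e` points, so forgetting coordinate `k y` is not injective
  -- on it.
  obtain ⟨c, hc, d, hd, hne, heq⟩ := Finset.exists_ne_map_eq_of_card_lt_of_maps_to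
    (s := Finset.univ.filter fun c => f c = y)
    (t := (Finset.univ : Finset ({i // i ≠ k y} → α)))
    (f := fun (c : ι → α) i => c i.1) (by
      rw [Finset.card_univ, Fintype.card_fun]
      simpa [Fintype.card_subtype_compl, he] using hy) (fun _ _ => Finset.mem_univ _)
  simp only [Finset.mem_filter, Finset.mem_univ, true_and] at hc hd
  refine ⟨c, d, hne, hc.trans hd.symm, fun i hi => ?_⟩
  rw [hc] at hi
  exact congrFun heq ⟨i, hi⟩

/-- Windows at the same position carry the same advice, so the exchange leaves the lower track
intact. -/
theorem track_swap {α Γ : Type} {x y : List α} {w : List Γ} (hx : x.length = w.length)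
    (hy : y.length = w.length) {X₁ X₂ X₃ Y₁ Y₂ Y₃ : List (α × Γ)}
    (hX : track x w = X₁ ++ X₂ ++ X₃) (hY : track y w = Y₁ ++ Y₂ ++ Y₃)
    (h₁ : X₁.length = Y₁.length) (h₂ : X₂.length = Y₂.length) :
    x = X₁.map Prod.fst ++ X₂.map Prod.fst ++ X₃.map Prod.fst ∧
      y = Y₁.map Prod.fst ++ Y₂.map Prod.fst ++ Y₃.map Prod.fst ∧
      track (X₁.map Prod.fst ++ Y₂.map Prod.fst ++ X₃.map Prod.fst) w = X₁ ++ Y₂ ++ X₃ := by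
  have hx₁ : (track x w).map Prod.fst = x := List.map_fst_zip hx.le
  have hx₂ : (track x w).map Prod.snd = w := List.map_snd_zip hx.ge
  have hy₁ : (track y w).map Prod.fst = y := List.map_fst_zip hy.le
  have hy₂ : (track y w).map Prod.snd = w := List.map_snd_zip hy.ge
  rw [hX, List.map_append, List.map_append] at hx₁ hx₂
  rw [hY, List.map_append, List.map_append] at hy₁ hy₂
  refine ⟨hx₁.symm, hy₁.symm, ?_⟩
  have hXY := hx₂.trans hy₂.symm
  have h := List.append_inj (List.append_inj hXY (by simp [h₁, h₂])).1 (by simp [h₁])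
  rw [h.2] at hx₂
  rw [← hx₂, ← List.map_append, ← List.map_append, ← List.map_append, ← List.map_append]
  exact (List.zip_of_prod rfl rfl).symm

/-- A factor of length more than `2 * b` covers a block of length `b` at a position divisible
by `b`. -/
theorem exists_block_in_window {b s l n : ℕ} (hb : 0 < b) (hl : 2 * b < l)
    (hn : s + l ≤ n * b) : ∃ q < n, s ≤ q * b ∧ (q + 1) * b ≤ s + l := by
  have h := Nat.div_add_mod s b
  have h' := Nat.mod_lt s hb
  rw [mul_comm] at h
  have hle : (s / b + 1 + 1) * b ≤ s + l := by
    rw [add_mul, add_mul, one_mul]; omega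
  refine ⟨s / b + 1, ?_, ?_, hle⟩
  · have := Nat.le_of_mul_le_mul_right (hle.trans hn) hb
    omega
  · rw [add_mul, one_mul]; omega

theorem mainTheorem10 : Equal6 ∉ AdvisedCFL Alphabet6 := by
  classical
  rintro ⟨Γ, _, _, h, _, hh, ⟨g, rfl⟩, hmem⟩
  obtain ⟨R, hR1, hR⟩ : ∃ R, 1 ≤ R ∧ ∀ r ∈ g.rules, r.output.length ≤ R :=
    ⟨g.rules.sup (fun r => r.output.length) + 1, by omega, fun r hr =>
      (Finset.le_sup (f := fun r => r.output.length) hr).trans (Nat.le_succ _)⟩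
  obtain ⟨m, hm⟩ : ∃ m, m = g.rules.card * (24 * R + 1) ^ 2 + 1 := ⟨_, rfl⟩
  -- With this `t`, the longest possible window, `R * (2 * (6 * m))`, is exactly half a word.
  obtain ⟨t, ht⟩ : ∃ t, t = 2 * R := ⟨_, rfl⟩
  have ht0 : 0 < t := by omega
  have hRm : m ≤ R * m := Nat.le_mul_of_pos_left m hR1
  have hn : t * (6 * m) + t * (6 * m) = 24 * (R * m) := by rw [ht]; ring
  have hRK : R * (2 * (6 * m)) = t * (6 * m) := by rw [ht]; ring
  let word : (Fin t → Fin 5 → Fin m) → List Alphabet6 := fun c => leftHalf c ++ rightHalf c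
  have hword : ∀ c, (word c).length = 24 * (R * m) := fun c => by
    rw [← hn, List.length_append, length_leftHalf, length_rightHalf]
  have hadv : ∀ c, (word c).length = (h (24 * (R * m))).length := fun c => by rw [hh, hword]
  have htrack : ∀ c, (track (word c) (h (24 * (R * m)))).length = 24 * (R * m) := fun c => by
    simp [track, hword, hh (24 * (R * m))]
  have hwindow := fun c => ContextFreeGrammar.exists_window_of_mem_language
    (w := track (word c) (h (24 * (R * m)))) (by
      rw [← hword c]
      exact (hmem _).1 (leftHalf_append_rightHalf_mem c)) hR
    (K := 2 * (6 * m)) (by omega) (by rw [htrack]; omega)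
  choose r hr x v y hxvy hv hv' hder hswap using hwindow
  have hlen : ∀ c, (x c).length + (v c).length + (y c).length = 24 * (R * m) := fun c => by
    rw [← htrack c, hxvy c]; simp [add_assoc]
  let κ := g.rules × Fin (24 * (R * m) + 1) × Fin (24 * (R * m) + 1)
  let f : (Fin t → Fin 5 → Fin m) → κ := fun c =>
    (⟨r c, hr c⟩, ⟨(x c).length, by have := hlen c; omega⟩, ⟨(v c).length, by have := hlen c; omega⟩)
  have hblock : ∀ p : κ, ∃ q : ℕ, 2 * (6 * m) < p.2.2.val → p.2.1.val + p.2.2.val ≤ 24 * (R * m) →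
      q < 2 * t ∧ p.2.1.val ≤ q * (6 * m) ∧ (q + 1) * (6 * m) ≤ p.2.1.val + p.2.2.val := by
    intro p
    -- Colors not arising from a window get the junk index `0`, as `q` must be total.
    by_cases hp : 2 * (6 * m) < p.2.2.val ∧ p.2.1.val + p.2.2.val ≤ 24 * (R * m)
    · obtain ⟨q, hq⟩ := exists_block_in_window (n := 2 * t) (by omega) hp.1
        (hp.2.trans (by rw [← hn, mul_assoc, two_mul]))
      exact ⟨q, fun _ _ => hq⟩
    · exact ⟨0, fun h h' => absurd ⟨h, h'⟩ hp⟩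
  choose q hq using hblock
  have hcard : Fintype.card κ < Fintype.card (Fin 5 → Fin m) := by
    have hle : 24 * (R * m) + 1 ≤ (24 * R + 1) * m := by
      rw [add_mul, one_mul, mul_assoc]; omega
    calc Fintype.card κ = g.rules.card * (24 * (R * m) + 1) ^ 2 := by
          simp [κ, sq]
      _ ≤ g.rules.card * ((24 * R + 1) * m) ^ 2 := by gcongr
      _ = g.rules.card * (24 * R + 1) ^ 2 * m ^ 2 := by ring
      _ < m * m ^ 2 := Nat.mul_lt_mul_of_pos_right (by omega) (pow_pos (by omega) 2)
      _ = m ^ 3 := by ring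
      _ ≤ m ^ 5 := Nat.pow_le_pow_right (by omega) (by omega)
      _ = Fintype.card (Fin 5 → Fin m) := by simp
  obtain ⟨c, d, hne, hf, hcd⟩ :=
    exists_ne_eq_off_of_card_lt f (fun p => ⟨q p % t, Nat.mod_lt _ ht0⟩) hcard
  have hrr : r c = r d := congrArg (fun p : κ => p.1.val) hf
  have hxx : (x c).length = (x d).length := congrArg (fun p : κ => p.2.1.val) hf
  have hvv : (v c).length = (v d).length := congrArg (fun p : κ => p.2.2.val) hf
  obtain ⟨hq₁, hq₂, hq₃⟩ := hq (f c) (hv c) (by have := hlen c; simp only [f]; omega)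
  obtain ⟨hc, hd, htr⟩ := track_swap (hadv c) (hadv d) (hxvy c) (hxvy d) hxx hvv
  have hE : (x c).map Prod.fst ++ (v d).map Prod.fst ++ (y c).map Prod.fst ∈ Equal6 := by
    rw [hmem]
    have : ((x c).map Prod.fst ++ (v d).map Prod.fst ++ (y c).map Prod.fst).length =
        24 * (R * m) := by
      have := hlen c
      simp only [List.length_append, List.length_map]
      omega
    rw [this, htr]
    exact hswap c _ (hrr ▸ hder d)
  rcases swap_halves ht0 hq₁ hcd hc hd (by simpa using hxx) (by simpa using hvv)
    (by simpa using hq₂) (by simpa using hq₃) (by simpa [← hRK] using hv' c) with hs | hs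
  · rw [hs] at hE
    exact hne (eq_of_leftHalf_append_rightHalf_mem (fun i hi => (hcd i hi).symm) hE).symm
  · rw [hs] at hE
    exact hne (eq_of_leftHalf_append_rightHalf_mem hcd hE)
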